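/- Let $(V,\mathcal{B})$ be a Steiner triple system of order $n=|V|\ge 1$: $V$ is a finite set with $n$ points and $\mathcal{B}$ is a set of $3$-element subsets of $V$, called blocks, such that every two distinct points of $V$ lie together in exactly one block. For every block $B=\{u,v,w\}\in\mathcal{B}$ let one of the two cyclic permutations $(u\,v\,w)$, $(u\,w\,v)$ of its points be prescribed. Then there is a cellular embedding of the complete graph $K_n$ on $V$ in a closed connected oriented surface such that every block bounds a triangular face on which the orientation of the surface induces the prescribed cyclic permutation of that block, and such that there is exactly one further face. Here a cellular embedding in an oriented surface is described, as usual, by its rotation system (a cyclic order, at each vertex, of the directed edges leaving that vertex), and its faces by the closed boundary walks obtained by face tracing; for $n=1$ the embedding is a single point on the sphere, with one face. -/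

import Mathlib

/-- A (partial) triple system on the point set `V`: a collection of 3-element subsets of `V`,
called blocks, such that every 2-element subset of `V` lies in at most one block. -/
structure TripleSystem (V : Type*) where
  blocks : Set (Finset V)
  card_eq_three : ∀ B ∈ blocks, B.card = 3
  eq_of_mem : ∀ u v : V, u ≠ v → ∀ B ∈ blocks, ∀ C ∈ blocks,
    u ∈ B → v ∈ B → u ∈ C → v ∈ C → B = C

namespace TripleSystem

variable {V : Type*}

/-- A Steiner triple system: every pair of distinct points lies in a block
(and then in exactly one, by `eq_of_mem`). -/
def IsSteiner (X : TripleSystem V) : Prop :=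
  ∀ u v : V, u ≠ v → ∃ B ∈ X.blocks, u ∈ B ∧ v ∈ B

/-- The associated graph: two distinct points are adjacent when some block contains both. -/
def graph (X : TripleSystem V) : SimpleGraph V where
  Adj u v := u ≠ v ∧ ∃ B ∈ X.blocks, u ∈ B ∧ v ∈ B
  symm := ⟨fun _ _ ⟨hne, B, hB, hu, hv⟩ => ⟨hne.symm, B, hB, hv, hu⟩⟩
  loopless := ⟨fun _ h => h.1 rfl⟩

/-- The associated graph of a Steiner triple system is the complete graph on its points. -/
theorem graph_eq_top_iff (X : TripleSystem V) : X.graph = ⊤ ↔ X.IsSteiner := by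
  constructor
  · intro h u v huv
    have : X.graph.Adj u v := by rw [h]; exact huv
    exact this.2
  · intro h
    ext u v
    exact ⟨fun hA => hA.1, fun hA => ⟨hA, h u v hA⟩⟩

/-- A choice of orientation for every block: `o B` is a cyclic permutation of the three points of
`B`, extended by the identity to all points. So `o B` is `(u v w)` or `(u w v)` if
`B = {u, v, w}`. -/
def IsOrientation (X : TripleSystem V) (o : X.blocks → Equiv.Perm V) : Prop :=
  ∀ B : X.blocks, (o B).IsCycle ∧ ∀ x : V, o B x ≠ x ↔ x ∈ (B : Finset V)

end TripleSystem

/-- A cellular embedding of the connected graph `G` in a closed connected oriented surface, up to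
orientation-preserving homeomorphism fixing the vertices and edges: a rotation at each vertex, i.e.
a cyclic order on the darts (directed edges) with that tail. `rot d` is the dart that follows `d`
in the clockwise order around the tail of `d`. -/
structure CellularEmbedding {V : Type*} (G : SimpleGraph V) where
  connected : G.Connected
  rot : Equiv.Perm G.Dart
  rot_fst : ∀ d : G.Dart, (rot d).fst = d.fst
  rot_sameCycle : ∀ d e : G.Dart, d.fst = e.fst → rot.SameCycle d e

namespace CellularEmbedding

variable {V : Type*} {G : SimpleGraph V}

/-- Face tracing: having traversed the dart `d`, from `u` to `v`, with a face on the left, the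
boundary of that face continues with the dart that follows the reverse of `d` in the
clockwise order at `v`. -/
def facePerm (M : CellularEmbedding G) : Equiv.Perm G.Dart :=
  (SimpleGraph.Dart.symm_involutive (G := G)).toPerm.trans M.rot

/-- The faces of the embedding. Every face of a graph with at least one edge is an orbit of the
face tracing permutation: the closed walk around its boundary, counterclockwise. A connected graph
without edges is one isolated vertex on the sphere, and the complement of that vertex is a face. -/
def Face (M : CellularEmbedding G) : Type _ :=
  Quotient (Equiv.Perm.SameCycle.setoid M.facePerm) ⊕ {v : V // ∀ w : V, ¬ G.Adj v w}

/-- The darts along the boundary walk of a face, each having the face on its left. -/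
def Face.darts {M : CellularEmbedding G} : M.Face → Set G.Dart
  | Sum.inl q => {d | Quotient.mk (Equiv.Perm.SameCycle.setoid M.facePerm) d = q}
  | Sum.inr _ => ∅

/-- The boundary walk of the face `F` is the oriented cycle of `G` that runs from `u` to `c u` for
each point `u` moved by the cyclic permutation `c`, passing along each of these darts once and along
no other dart. -/
def IsBoundedBy {M : CellularEmbedding G} (F : M.Face) (c : Equiv.Perm V) : Prop :=
  (∀ u : V, c u ≠ u → G.Adj u (c u)) ∧ ∀ d : G.Dart, d ∈ F.darts ↔ c d.fst = d.snd

end CellularEmbedding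

namespace TripleSystem

variable {V : Type*}

/-- `M` is an upper embedding of `X` inducing the orientations `o`: every block bounds a face, on
which the oriented surface induces the prescribed cyclic permutation of the block, and there is
exactly one further (outer) face. -/
def IsUpperEmbedding (X : TripleSystem V) (o : X.blocks → Equiv.Perm V)
    (M : CellularEmbedding X.graph) : Prop :=
  (∀ B : X.blocks, ∃ F : M.Face, CellularEmbedding.IsBoundedBy F (o B)) ∧
    ∃! F : M.Face, ∀ B : X.blocks, ¬ CellularEmbedding.IsBoundedBy F (o B)

/-- Upper embeddability in every orientation of triples. -/
def UpperEmbeddableInEveryOrientation (X : TripleSystem V) : Prop :=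
  ∀ o : X.blocks → Equiv.Perm V, X.IsOrientation o →
    ∃ M : CellularEmbedding X.graph, X.IsUpperEmbedding o M

end TripleSystem

/-!
A flag is a pair of a point and a block through it. The prescribed cyclic permutations of the blocks
give a permutation `σ` of the flags, and every permutation `ρ` of the flags that has one cycle for
each point gives an embedding: every flag `(v, B)` has a forward dart from `v` to `o B v` and a
backward dart from `v` to `(o B)⁻¹ v`, which the rotation makes consecutive, and `ρ` orders
these pairs around `v`. Face tracing then follows `σ` on the forward darts, which gives the
prescribed face of each block, and `ρ * σ⁻¹` on the backward darts. So the theorem asks for a `ρ`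
such that `ρ * σ⁻¹` is a single cycle (`TripleSystem.exists_rotation`,
`TripleSystem.IsOrientation.isUpperEmbedding_embedding`). Equivalently, the point-block incidence
graph, with prescribed rotations at the blocks, is to have an embedding with one face.

As in Xuong's theorem on maximum genus, such a `ρ` comes from a spanning tree of the incidence graph
in which every point has an even number of cotree edges. The tree alone has one face. At a point
`v`, two further flags `p` and `q` can be inserted next to a flag `s` of the tree without changing
the number of faces, since multiplying a full cycle by one of the two cyclic permutations of `s`,
`p`, `q` gives a full cycle again (`exists_swap_mul_swap_mul_sameCycle`, `exists_rotation_of_even`).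

The tree consists of all flags of the blocks through a point `c`, and of one flag `(f B, B)` for each
other block `B`. The parity condition says that each point `v ≠ c` lies in an even number of blocks
`B` off `c` with `f B ≠ v` (`TripleSystem.exists_even_choice`). To choose `f`, let `{c, a, a'}` be a
block. By Hall's theorem the points off this block have distinct representatives among the other
blocks through `a` or `a'`, and each of these points can be given the right parity by means of its
representative. The number of all cotree edges is even, so the parity is wrong at both of `a` and
`a'` or at neither. If it is wrong, choose a suitable point `y` in its two blocks through `a` and
through `a'`, where `a` and `a'` were chosen before: this changes the parity at `a` and `a'` only.
-/

/-! ### Multiplying a permutation by a transposition -/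

/-- In a finite type, a reflexive transitive relation between each `x` and `f x` relates any two
points in the same cycle of `f`; symmetry is not needed, since nonnegative powers suffice. -/
theorem Equiv.Perm.SameCycle.rel {α : Type*} [Finite α] {f : Equiv.Perm α} {r : α → α → Prop}
    (refl : ∀ x, r x x) (trans : ∀ x y z, r x y → r y z → r x z) (step : ∀ x, r x (f x))
    {x y : α} (h : f.SameCycle x y) : r x y := by
  obtain ⟨i, rfl⟩ := h.exists_nat_pow_eq
  clear h
  induction i with
  | zero => exact refl x
  | succ i ih =>
    rw [pow_succ', Equiv.Perm.mul_apply]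
    exact trans _ _ _ ih (step _)

theorem Equiv.Perm.sameCycle_apply_self {α : Type*} (f : Equiv.Perm α) (x : α) :
    f.SameCycle x (f x) :=
  Equiv.Perm.sameCycle_apply_right.2 (Equiv.Perm.SameCycle.refl f x)

section Swap

variable {α : Type*} [Finite α] [DecidableEq α]

/-- A transposition of points in different cycles merges these cycles. -/
theorem sameCycle_swap_mul_self {π : Equiv.Perm α} {s p : α} (h : ¬ π.SameCycle s p) :
    (Equiv.swap s p * π).SameCycle s p := by
  have key : ∀ k : ℕ, (Equiv.swap s p * π).SameCycle s ((π ^ k) s) := by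
    intro k
    induction k with
    | zero => exact Equiv.Perm.SameCycle.refl _ _
    | succ k ih =>
      rw [pow_succ', Equiv.Perm.mul_apply]
      have hp : π ((π ^ k) s) ≠ p := by
        rintro rfl
        exact h ⟨k + 1, by rw [← Nat.cast_succ, zpow_natCast, pow_succ']; rfl⟩
      by_cases hs : π ((π ^ k) s) = s
      · rw [hs]
      · have := Equiv.Perm.sameCycle_apply_self (Equiv.swap s p * π) ((π ^ k) s)
        rw [Equiv.Perm.mul_apply, Equiv.swap_apply_of_ne_of_ne hs hp] at this
        exact ih.trans this
  -- The predecessor of `s` under `π` is reached from `s`, and is then sent to `p`.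
  obtain ⟨k, hk⟩ := (Equiv.Perm.sameCycle_symm_apply_right.2 (.refl π s)).exists_nat_pow_eq
  have h2 := Equiv.Perm.sameCycle_apply_self (Equiv.swap s p * π) (π.symm s)
  rw [Equiv.Perm.mul_apply, Equiv.apply_symm_apply, Equiv.swap_apply_left, ← hk] at h2
  exact (key k).trans h2

theorem sameCycle_swap_mul {π : Equiv.Perm α} {s p : α} (h : ¬ π.SameCycle s p) {a b : α}
    (hab : π.SameCycle a b) : (Equiv.swap s p * π).SameCycle a b := by
  have hsp := sameCycle_swap_mul_self h
  refine hab.rel (fun x => Equiv.Perm.SameCycle.refl _ x) (fun _ _ _ => .trans) fun x => ?_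
  have hx := Equiv.Perm.sameCycle_apply_self (Equiv.swap s p * π) x
  rw [Equiv.Perm.mul_apply] at hx
  by_cases h1 : π x = s
  · rw [h1, Equiv.swap_apply_left] at hx
    rw [h1]; exact hx.trans hsp.symm
  by_cases h2 : π x = p
  · rw [h2, Equiv.swap_apply_right] at hx
    rw [h2]; exact hx.trans hsp
  rwa [Equiv.swap_apply_of_ne_of_ne h1 h2] at hx

theorem sign_eq_of_forall_sameCycle [Fintype α] [Nontrivial α] {π : Equiv.Perm α}
    (h : ∀ a b, π.SameCycle a b) : Equiv.Perm.sign π = -(-1) ^ Fintype.card α := by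
  have hne : ∀ a, π a ≠ a := by
    intro a ha
    obtain ⟨b, hb⟩ := exists_ne a
    have := (h a b).rel (r := fun x y => x = a → y = a) (fun _ h => h)
      (fun _ _ _ h1 h2 h => h2 (h1 h))
      (fun x hx => by rw [hx, ha])
    exact hb (this rfl)
  have hc : π.IsCycle := by
    obtain ⟨a, -⟩ := exists_ne (Classical.arbitrary α)
    exact ⟨a, hne a, fun b _ => h a b⟩
  have hs : π.support = Finset.univ := by
    ext a; simp [hne a]
  rw [hc.sign, hs, Finset.card_univ]

/-- A transposition splits a full cycle: otherwise the two full cycles would have the same sign. -/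
theorem not_sameCycle_swap_mul {π : Equiv.Perm α} (h : ∀ a b, π.SameCycle a b) {s p : α}
    (hsp : s ≠ p) : ¬ (Equiv.swap s p * π).SameCycle s p := by
  intro hc
  have := Fintype.ofFinite α
  have : Nontrivial α := ⟨s, p, hsp⟩
  -- Every point lies in the cycle of `s` or of `p`, so the product would be a full cycle.
  have hs : ∀ a, (Equiv.swap s p * π).SameCycle s a := by
    intro a
    refine (h s a).rel (r := fun x y => (Equiv.swap s p * π).SameCycle s x →
      (Equiv.swap s p * π).SameCycle s y) (fun _ h => h) (fun _ _ _ h1 h2 h => h2 (h1 h)) ?_ .rfl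
    intro x hx
    by_cases h1 : π x = s
    · rw [h1]
    by_cases h2 : π x = p
    · rwa [h2]
    have := Equiv.Perm.sameCycle_apply_self (Equiv.swap s p * π) x
    rw [Equiv.Perm.mul_apply, Equiv.swap_apply_of_ne_of_ne h1 h2] at this
    exact hx.trans this
  have e1 := sign_eq_of_forall_sameCycle h
  have e2 := sign_eq_of_forall_sameCycle fun a b => (hs a).symm.trans (hs b)
  rw [Equiv.Perm.sign_mul, Equiv.Perm.sign_swap hsp, ← e1] at e2
  refine absurd e2 ?_
  rcases Int.units_eq_one_or (Equiv.Perm.sign π) with h | h <;> rw [h] <;> decide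

theorem sameCycle_swap_mul_or {π : Equiv.Perm α} (h : ∀ a b, π.SameCycle a b) (s p a : α) :
    (Equiv.swap s p * π).SameCycle s a ∨ (Equiv.swap s p * π).SameCycle p a := by
  refine (h s a).rel (r := fun x y =>
    ((Equiv.swap s p * π).SameCycle s x ∨ (Equiv.swap s p * π).SameCycle p x) →
      ((Equiv.swap s p * π).SameCycle s y ∨ (Equiv.swap s p * π).SameCycle p y))
    (fun _ h => h) (fun _ _ _ h1 h2 h => h2 (h1 h)) ?_ (.inl .rfl)
  intro x hx
  by_cases h1 : π x = s
  · rw [h1]; exact .inl .rfl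
  by_cases h2 : π x = p
  · rw [h2]; exact .inr .rfl
  have := Equiv.Perm.sameCycle_apply_self (Equiv.swap s p * π) x
  rw [Equiv.Perm.mul_apply, Equiv.swap_apply_of_ne_of_ne h1 h2] at this
  exact hx.imp (·.trans this) (·.trans this)

/-- A full cycle `π` stays a full cycle after multiplication by one of the two cyclic permutations
of three given points: the first transposition splits off a cycle, and the third point lies apart
from one of the first two, so the second transposition reunites the cycles. -/
theorem exists_swap_mul_swap_mul_sameCycle {π : Equiv.Perm α} (h : ∀ a b, π.SameCycle a b)
    {s p : α} (hsp : s ≠ p) (q : α) : ∃ t, (t = s ∨ t = p) ∧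
      ∀ a b, (Equiv.swap t q * (Equiv.swap s p * π)).SameCycle a b := by
  have h0 := not_sameCycle_swap_mul h hsp
  have h1 := sameCycle_swap_mul_or h s p
  rcases h1 q with hq | hq
  · refine ⟨p, .inr rfl, ?_⟩
    have hn : ¬ (Equiv.swap s p * π).SameCycle p q := fun h => h0 (hq.trans h.symm)
    have hm := sameCycle_swap_mul_self hn
    have ha : ∀ a, (Equiv.swap p q * (Equiv.swap s p * π)).SameCycle p a := by
      intro a
      rcases h1 a with ha | ha
      · exact hm.trans (sameCycle_swap_mul hn (hq.symm.trans ha))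
      · exact sameCycle_swap_mul hn ha
    exact fun a b => (ha a).symm.trans (ha b)
  · refine ⟨s, .inl rfl, ?_⟩
    have hn : ¬ (Equiv.swap s p * π).SameCycle s q := fun h => h0 (h.trans hq.symm)
    have hm := sameCycle_swap_mul_self hn
    have ha : ∀ a, (Equiv.swap s q * (Equiv.swap s p * π)).SameCycle s a := by
      intro a
      rcases h1 a with ha | ha
      · exact sameCycle_swap_mul hn ha
      · exact hm.trans (sameCycle_swap_mul hn (hq.symm.trans ha))
    exact fun a b => (ha a).symm.trans (ha b)

end Swap

/-! ### Rotations of the flags making a one-face map -/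

section Rotation

variable {F V β : Type*}

theorem not_sameCycle_of_apply_eq_self {ρ : Equiv.Perm F} {s p : F} (hp : ρ p = p) (hsp : s ≠ p) :
    ¬ ρ.SameCycle s p :=
  fun h => hsp (h.eq_of_right hp)

theorem apply_swap_of_eq [DecidableEq F] (pt : F → V) {s p : F} (h : pt s = pt p) (q : F) :
    pt (Equiv.swap s p q) = pt q := by
  rw [Equiv.swap_apply_def]
  split_ifs with h1 h2
  · rw [h1, h]
  · rw [h2, h]
  · rfl

variable [Finite F] [DecidableEq F]

/-- `C` is a set of flags outside the rotation `ρ`, which has one cycle on the other flags at each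
point, and `ρ * τ` is a full cycle, so that there is one face. If an even number of the flags at
each point belong to `C`, they can be added to the rotation in pairs without creating faces. -/
theorem exists_rotation_of_even (τ : Equiv.Perm F) (pt : F → V) (C : Finset F) (ρ : Equiv.Perm F)
    (hfix : ∀ q ∈ C, ρ q = q) (hpt : ∀ q, pt (ρ q) = pt q)
    (hsame : ∀ p q, p ∉ C → q ∉ C → pt p = pt q → ρ.SameCycle p q)
    (hface : ∀ a b, (ρ * τ).SameCycle a b) (hmeet : ∀ q, ∃ s, s ∉ C ∧ pt s = pt q)
    (heven : ∀ v, Even {q ∈ (C : Set F) | pt q = v}.ncard) :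
    ∃ ρ' : Equiv.Perm F, (∀ q, pt (ρ' q) = pt q) ∧ (∀ p q, pt p = pt q → ρ'.SameCycle p q) ∧
      ∀ a b, (ρ' * τ).SameCycle a b := by
  induction C using Finset.strongInduction generalizing ρ with
  | H C ih =>
  rcases C.eq_empty_or_nonempty with rfl | ⟨p, hp⟩
  · exact ⟨ρ, hpt, fun p q => hsame p q (by simp) (by simp), hface⟩
  obtain ⟨q, ⟨hq, hqp⟩, hne⟩ : ∃ q ∈ {q ∈ (C : Set F) | pt q = pt p}, q ≠ p := by
    apply Set.exists_ne_of_one_lt_ncard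
    have h1 : 0 < {q ∈ (C : Set F) | pt q = pt p}.ncard :=
      (Set.ncard_pos (Set.toFinite _)).2 ⟨p, hp, rfl⟩
    have h2 := heven (pt p)
    by_contra h3
    rw [show {q ∈ (C : Set F) | pt q = pt p}.ncard = 1 by omega] at h2
    exact absurd h2 (by decide)
  have hq : q ∈ C := hq
  obtain ⟨s, hs, hsp⟩ := hmeet p
  have hsp' : s ≠ p := by rintro rfl; exact hs hp
  have hsq' : s ≠ q := by rintro rfl; exact hs hq
  obtain ⟨t, ht, hface'⟩ := exists_swap_mul_swap_mul_sameCycle hface hsp' q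
  have htq : t ≠ q := by rcases ht with rfl | rfl; exacts [hsq', hne.symm]
  have hpt' : pt t = pt q := by rcases ht with rfl | rfl; exacts [hsp.trans hqp.symm, hqp.symm]
  have n1 := not_sameCycle_of_apply_eq_self (hfix p hp) hsp'
  have n2 : ¬ (Equiv.swap s p * ρ).SameCycle t q := by
    refine not_sameCycle_of_apply_eq_self ?_ htq
    rw [Equiv.Perm.mul_apply, hfix q hq, Equiv.swap_apply_of_ne_of_ne hsq'.symm hne]
  have sp1 := sameCycle_swap_mul n2 (sameCycle_swap_mul_self n1)
  have tq1 := sameCycle_swap_mul_self n2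
  have sq1 : (Equiv.swap t q * (Equiv.swap s p * ρ)).SameCycle s q := by
    rcases ht with rfl | rfl
    exacts [tq1, sp1.trans tq1]
  -- Any flag of the rotation at the point of `p` is now in the cycle of `s`.
  have toS : ∀ x, x ∉ (C.erase p).erase q → pt x = pt p →
      (Equiv.swap t q * (Equiv.swap s p * ρ)).SameCycle s x := by
    intro x hx hxp
    by_cases h1 : x = q
    · rw [h1]; exact sq1
    by_cases h2 : x = p
    · rw [h2]; exact sp1
    have hxC : x ∉ C := fun h => hx (by simp [h1, h2, h])
    exact sameCycle_swap_mul n2 (sameCycle_swap_mul n1 (hsame _ _ hs hxC (hsp.trans hxp.symm)))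
  refine ih ((C.erase p).erase q) ?_ (Equiv.swap t q * (Equiv.swap s p * ρ)) ?_ ?_ ?_ hface' ?_ ?_
  · exact (Finset.erase_subset _ _).trans_ssubset (Finset.erase_ssubset hp)
  · intro x hx
    simp only [Finset.mem_erase] at hx
    obtain ⟨h1, h2, h3⟩ := hx
    have hxs : x ≠ s := by rintro rfl; exact hs h3
    have hxt : x ≠ t := by rcases ht with rfl | rfl <;> assumption
    rw [Equiv.Perm.mul_apply, Equiv.Perm.mul_apply, hfix x h3,
      Equiv.swap_apply_of_ne_of_ne hxs h2, Equiv.swap_apply_of_ne_of_ne hxt h1]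
  · intro x
    rw [Equiv.Perm.mul_apply, Equiv.Perm.mul_apply, apply_swap_of_eq pt hpt',
      apply_swap_of_eq pt hsp, hpt]
  · intro x y hx hy hxy
    by_cases hxp : pt x = pt p
    · exact (toS x hx hxp).symm.trans (toS y hy (hxy.symm.trans hxp))
    · have h1 : ∀ z, z ∉ (C.erase p).erase q → pt z ≠ pt p → z ∉ C := by
        intro z hz hzp hzC
        refine hz ?_
        simp only [Finset.mem_erase]
        refine ⟨?_, ?_, hzC⟩ <;> rintro rfl
        exacts [hzp hqp, hzp rfl]
      exact sameCycle_swap_mul n2 (sameCycle_swap_mul n1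
        (hsame _ _ (h1 x hx hxp) (h1 y hy (hxy ▸ hxp)) hxy))
  · intro x
    obtain ⟨z, hz, hzx⟩ := hmeet x
    exact ⟨z, fun h => hz (Finset.mem_of_mem_erase (Finset.mem_of_mem_erase h)), hzx⟩
  · intro v
    by_cases hv : v = pt p
    · subst hv
      have e1 : {x ∈ (((C.erase p).erase q : Finset F) : Set F) | pt x = pt p} =
          ({x ∈ (C : Set F) | pt x = pt p} \ {p}) \ {q} := by
        ext x; simp; tauto
      have hp1 : p ∈ {x ∈ (C : Set F) | pt x = pt p} := ⟨hp, rfl⟩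
      have hq1 : q ∈ {x ∈ (C : Set F) | pt x = pt p} \ {p} := ⟨⟨hq, hqp⟩, hne⟩
      have c1 := Set.ncard_sdiff_singleton_add_one hp1 (Set.toFinite _)
      have c2 := Set.ncard_sdiff_singleton_add_one hq1 (Set.toFinite _)
      have := heven (pt p)
      rw [e1]
      grind
    · have e1 : {x ∈ (((C.erase p).erase q : Finset F) : Set F) | pt x = v} =
          {x ∈ (C : Set F) | pt x = v} := by
        ext x
        simp only [Finset.coe_erase, Set.mem_sdiff, Set.mem_singleton_iff, Set.mem_sep_iff]
        refine ⟨fun h => ⟨h.1.1.1, h.2⟩, fun h => ⟨⟨⟨h.1, ?_⟩, ?_⟩, h.2⟩⟩ <;> rintro rfl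
        exacts [hv h.2.symm, hv (h.2.symm.trans hqp)]
      rw [e1]
      exact heven v

/-- The state of growing a one-face map along a tree: `A` is the set of flags that the tree is to
use, and `K` is the set of blocks attached so far. The rotation `ρ` moves only flags of `A` in
blocks of `K`, has one cycle on these flags at each point, and the flags of the blocks in `K`
lie along a single face. -/
structure IsTreeRotation (τ : Equiv.Perm F) (pt : F → V) (blk : F → β) (A : Set F) (K : Set β)
    (ρ : Equiv.Perm F) : Prop where
  fix_of_block : ∀ q, blk q ∉ K → ρ q = q
  fix_of_flag : ∀ q, q ∉ A → ρ q = q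
  point : ∀ q, pt (ρ q) = pt q
  sameCycle : ∀ p q, p ∈ A → q ∈ A → blk p ∈ K → blk q ∈ K → pt p = pt q → ρ.SameCycle p q
  face_of_block : ∀ a b, blk a = blk b → (ρ * τ).SameCycle a b
  face : ∀ a b, blk a ∈ K → blk b ∈ K → (ρ * τ).SameCycle a b

/-- Attaching a further block at its flag `p`, next to the flag `s` at the same point. -/
theorem IsTreeRotation.insert {τ : Equiv.Perm F} {pt : F → V} {blk : F → β} {A : Set F} {K : Set β}
    {ρ : Equiv.Perm F} (h : IsTreeRotation τ pt blk A K ρ) (hτ : ∀ q, blk (τ q) = blk q)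
    (hinj : ∀ p q, pt p = pt q → blk p = blk q → p = q) {s p : F} (hp : p ∈ A) (hs : s ∈ A)
    (hpK : blk p ∉ K) (hsK : blk s ∈ K) (hsp : pt s = pt p)
    (hA : ∀ q ∈ A, blk q = blk p → q = p ∨ ∀ r ∈ A, blk r ∈ K → pt r ≠ pt q) :
    IsTreeRotation τ pt blk A (insert (blk p) K) (Equiv.swap s p * ρ) := by
  have hsp' : s ≠ p := by rintro rfl; exact hpK hsK
  have n1 := not_sameCycle_of_apply_eq_self (h.fix_of_block p hpK) hsp'
  have hK : ∀ q, blk (ρ q) ∈ K ↔ blk q ∈ K := by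
    intro q
    by_cases hq : blk q ∈ K
    · refine iff_of_true ?_ hq
      by_contra h2
      exact h2 (by rwa [ρ.injective (h.fix_of_block _ h2)])
    · rw [h.fix_of_block q hq]
  have n2 : ¬ (ρ * τ).SameCycle s p := by
    intro hc
    have := hc.rel (r := fun x y => blk x ∈ K ↔ blk y ∈ K) (fun _ => Iff.rfl)
      (fun _ _ _ => Iff.trans) (fun x => by rw [Equiv.Perm.mul_apply, hK, hτ])
    exact hpK (this.1 hsK)
  have sp1 := sameCycle_swap_mul_self n1
  have sp2 := sameCycle_swap_mul_self n2
  have main : ∀ a, blk a ∈ Insert.insert (blk p) K → (Equiv.swap s p * (ρ * τ)).SameCycle s a := by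
    rintro a (ha | ha)
    · exact sp2.trans (sameCycle_swap_mul n2 (h.face_of_block _ _ ha.symm))
    · exact sameCycle_swap_mul n2 (h.face _ _ hsK ha)
  have cross : ∀ a b, a ∈ A → b ∈ A → blk a = blk p → blk b ∈ K → pt a = pt b →
      (Equiv.swap s p * ρ).SameCycle a b := by
    intro a b ha hb hap hbK hab
    rcases hA a ha hap with rfl | h3
    · exact sp1.symm.trans (sameCycle_swap_mul n1 (h.sameCycle _ _ hs hb hsK hbK (hsp.trans hab)))
    · exact absurd hab.symm (h3 b hb hbK)
  refine ⟨?_, ?_, ?_, ?_, ?_, ?_⟩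
  · intro q hq
    rw [Set.mem_insert_iff, not_or] at hq
    rw [Equiv.Perm.mul_apply, h.fix_of_block q hq.2, Equiv.swap_apply_of_ne_of_ne]
    · rintro rfl; exact hq.2 hsK
    · rintro rfl; exact hq.1 rfl
  · intro q hq
    rw [Equiv.Perm.mul_apply, h.fix_of_flag q hq, Equiv.swap_apply_of_ne_of_ne] <;> rintro rfl
    exacts [hq hs, hq hp]
  · intro q
    rw [Equiv.Perm.mul_apply, apply_swap_of_eq pt hsp, h.point]
  · rintro a b ha hb (ha1 | ha1) (hb1 | hb1) hab
    · rw [hinj a b hab (ha1.trans hb1.symm)]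
    · exact cross a b ha hb ha1 hb1 hab
    · exact (cross b a hb ha hb1 ha1 hab.symm).symm
    · exact sameCycle_swap_mul n1 (h.sameCycle a b ha hb ha1 hb1 hab)
  · intro a b hab
    rw [mul_assoc]
    exact sameCycle_swap_mul n2 (h.face_of_block a b hab)
  · intro a b ha hb
    rw [mul_assoc]
    exact (main a ha).symm.trans (main b hb)

end Rotation

/-! ### Choosing a point of every block away from a given point -/

namespace TripleSystem

variable {V : Type*}

theorem exists_eq_insert (X : TripleSystem V) [DecidableEq V] {B : Finset V} (hB : B ∈ X.blocks)
    {x y : V} (hx : x ∈ B) (hy : y ∈ B) (hxy : x ≠ y) :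
    ∃ z, z ≠ x ∧ z ≠ y ∧ B = {x, y, z} := by
  have h3 := X.card_eq_three B hB
  have h1 : ((B.erase x).erase y).card = 1 := by
    rw [Finset.card_erase_of_mem (by simp [hy, hxy.symm]), Finset.card_erase_of_mem hx, h3]
  obtain ⟨z, hz⟩ := Finset.card_eq_one.1 h1
  have hz' : z ∈ (B.erase x).erase y := by simp [hz]
  simp only [Finset.mem_erase] at hz'
  refine ⟨z, hz'.2.1, hz'.1, ?_⟩
  rw [← hz, Finset.insert_erase (by simp [hy, hxy.symm]), Finset.insert_erase hx]

theorem nonempty_of_mem (X : TripleSystem V) (B : X.blocks) : ∃ v, v ∈ (B : Finset V) :=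
  Finset.card_pos.1 (by rw [X.card_eq_three B B.2]; norm_num)

theorem block_eq (X : TripleSystem V) {u v : V} (h : u ≠ v) {B C : X.blocks}
    (hu : u ∈ (B : Finset V)) (hv : v ∈ (B : Finset V)) (hu' : u ∈ (C : Finset V))
    (hv' : v ∈ (C : Finset V)) : B = C :=
  Subtype.ext (X.eq_of_mem u v h B B.2 C C.2 hu hv hu' hv')

/-- Each point off the block `{c, a, a'}` lies in two blocks that meet this block in `a` or `a'`. -/
theorem card_blocks_through (X : TripleSystem V) (hX : X.IsSteiner) [DecidableEq V]
    [Fintype X.blocks] {c a a' : V} (B₀ : X.blocks) (hB₀ : (B₀ : Finset V) = {c, a, a'})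
    (hca : c ≠ a) (hca' : c ≠ a') (haa' : a ≠ a') {x : V} (hx : x ∉ (B₀ : Finset V)) :
    (Finset.univ.filter fun B : X.blocks => c ∉ (B : Finset V) ∧ x ∈ (B : Finset V) ∧
      (a ∈ (B : Finset V) ∨ a' ∈ (B : Finset V))).card = 2 := by
  have hc0 : c ∈ (B₀ : Finset V) := by simp [hB₀]
  have ha0 : a ∈ (B₀ : Finset V) := by simp [hB₀]
  have ha0' : a' ∈ (B₀ : Finset V) := by simp [hB₀]
  have hxa : x ≠ a := by rintro rfl; exact hx ha0
  have hxa' : x ≠ a' := by rintro rfl; exact hx ha0'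
  obtain ⟨A, hA, hxA, haA⟩ := hX x a hxa
  obtain ⟨A', hA', hxA', haA'⟩ := hX x a' hxa'
  rw [Finset.card_eq_two]
  refine ⟨⟨A, hA⟩, ⟨A', hA'⟩, ?_, ?_⟩
  · intro h
    have h : A = A' := congrArg Subtype.val h
    subst h
    have := X.block_eq haa' (B := ⟨A, hA⟩) haA haA' ha0 ha0'
    rw [← this] at hx
    exact hx hxA
  · ext B
    simp only [Finset.mem_filter, Finset.mem_univ, true_and, Finset.mem_insert,
      Finset.mem_singleton]
    constructor
    · rintro ⟨-, h1, h2 | h2⟩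
      · exact .inl (X.block_eq hxa h1 h2 hxA haA)
      · exact .inr (X.block_eq hxa' h1 h2 hxA' haA')
    · rintro (rfl | rfl)
      · refine ⟨fun h => hx ?_, hxA, .inl haA⟩
        rw [← X.block_eq hca (B := ⟨A, hA⟩) h haA hc0 ha0]; exact hxA
      · refine ⟨fun h => hx ?_, hxA', .inr haA'⟩
        rw [← X.block_eq hca' (B := ⟨A', hA'⟩) h haA' hc0 ha0']; exact hxA'

/-- The points off the block `{c, a, a'}` have distinct representatives among the other blocks that
pass through `a` or `a'`: every point lies in two of these and every one of these contains two of
the points, so that Hall's theorem applies. -/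
theorem exists_injOn_block (X : TripleSystem V) (hX : X.IsSteiner) [Finite V]
    [DecidableEq V] {c a a' : V} (B₀ : X.blocks) (hB₀ : (B₀ : Finset V) = {c, a, a'})
    (hca : c ≠ a) (hca' : c ≠ a') (haa' : a ≠ a') :
    ∃ h : V → X.blocks, (∀ x, x ∉ (B₀ : Finset V) → c ∉ (h x : Finset V) ∧ x ∈ (h x : Finset V) ∧
      (a ∈ (h x : Finset V) ∨ a' ∈ (h x : Finset V))) ∧
      ∀ x y, x ∉ (B₀ : Finset V) → y ∉ (B₀ : Finset V) → h x = h y → x = y := by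
  classical
  have := Fintype.ofFinite V
  have := Fintype.ofFinite X.blocks
  let t : {x // x ∉ (B₀ : Finset V)} → Finset X.blocks := fun x =>
    Finset.univ.filter fun B : X.blocks => c ∉ (B : Finset V) ∧ (x : V) ∈ (B : Finset V) ∧
      (a ∈ (B : Finset V) ∨ a' ∈ (B : Finset V))
  have ht : ∀ x, (t x).card = 2 := fun x =>
    X.card_blocks_through hX B₀ hB₀ hca hca' haa' x.2
  obtain ⟨h, hinj, hh⟩ := (Finset.all_card_le_biUnion_card_iff_exists_injective t).1 (by
    intro S
    have := Finset.card_mul_le_card_mul (s := S) (t := S.biUnion t) (m := 2) (n := 2)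
      (fun x B => B ∈ t x) ?_ ?_
    · omega
    · intro x hx
      rw [← ht x]
      refine Finset.card_le_card fun B hB => ?_
      rw [Finset.mem_bipartiteAbove]
      exact ⟨Finset.mem_biUnion.2 ⟨x, hx, hB⟩, hB⟩
    · intro B hB
      obtain ⟨x, -, hxB⟩ := Finset.mem_biUnion.1 hB
      obtain ⟨-, -, hα⟩ := (Finset.mem_filter.1 hxB).2
      obtain ⟨α, hα, hα0⟩ : ∃ α ∈ (B : Finset V), α ∈ (B₀ : Finset V) := by
        rcases hα with h | h
        exacts [⟨a, h, by simp [hB₀]⟩, ⟨a', h, by simp [hB₀]⟩]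
      have hc : ((B : Finset V).erase α).card = 2 := by
        rw [Finset.card_erase_of_mem hα, X.card_eq_three B B.2]
      rw [← hc]
      refine Finset.card_le_card_of_injOn Subtype.val ?_ Subtype.val_injective.injOn
      intro y hy
      have hy := (Finset.mem_bipartiteBelow _).1 hy
      have := (Finset.mem_filter.1 hy.2).2.2.1
      refine Finset.mem_coe.2 (Finset.mem_erase.2 ⟨?_, this⟩)
      intro hyα
      exact y.2 (hyα ▸ hα0))
  refine ⟨fun x => if hx : x ∉ (B₀ : Finset V) then h ⟨x, hx⟩ else B₀, ?_, ?_⟩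
  · intro x hx
    simp only [hx, not_false_eq_true, dif_pos]
    exact (Finset.mem_filter.1 (hh ⟨x, hx⟩)).2
  · intro x y hx hy hxy
    simp only [hx, hy, not_false_eq_true, dif_pos] at hxy
    exact congrArg Subtype.val (hinj hxy)

/-- The numbers of blocks off `c` at which a point is not the chosen one add up to an even number,
since each block has two points that are not chosen. -/
theorem even_sum_card_not_chosen (X : TripleSystem V) [Fintype V] [DecidableEq V]
    [Fintype X.blocks] (c : V) (f : X.blocks → V) (hf : ∀ B : X.blocks, f B ∈ (B : Finset V)) :
    Even (∑ v, (Finset.univ.filter fun B : X.blocks =>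
      c ∉ (B : Finset V) ∧ v ∈ (B : Finset V) ∧ f B ≠ v).card) := by
  have h := Finset.sum_card_bipartiteAbove_eq_sum_card_bipartiteBelow
    (s := (Finset.univ : Finset V))
    (t := Finset.univ.filter fun B : X.blocks => c ∉ (B : Finset V))
    (fun v (B : X.blocks) => v ∈ (B : Finset V) ∧ f B ≠ v)
  have h1 : ∀ v, (Finset.univ.filter fun B : X.blocks =>
      c ∉ (B : Finset V) ∧ v ∈ (B : Finset V) ∧ f B ≠ v) =
      Finset.bipartiteAbove (fun v (B : X.blocks) => v ∈ (B : Finset V) ∧ f B ≠ v)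
        (Finset.univ.filter fun B : X.blocks => c ∉ (B : Finset V)) v := by
    intro v
    ext B
    simp [Finset.bipartiteAbove]
  simp only [h1]
  rw [h]
  refine Finset.even_sum _ fun B _ => ?_
  have h2 : Finset.bipartiteBelow (fun v (B : X.blocks) => v ∈ (B : Finset V) ∧ f B ≠ v)
      Finset.univ B = (B : Finset V).erase (f B) := by
    ext v
    simp [Finset.bipartiteBelow, and_comm, eq_comm]
  rw [h2, Finset.card_erase_of_mem (hf B), X.card_eq_three B B.2]
  decide

/-- The main case of `exists_even_choice`, with `h` the distinct representatives given by
`exists_injOn_block`. Here `h x₀ = {a, x₀, y}`, and the choice in the blocks disjoint from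
`{c, a, a'}` is arranged so that `x₀` and `y` have the right parity at once. Every other point `z`
off `{c, a, a'}` is corrected by choosing it in `h z` where necessary. If the parity is then wrong
at `a`, it is so at `a'` too, and choosing `y` in both `h x₀` and `h y`, instead of `a` and `a'`,
corrects both. -/
theorem exists_even_choice_of_injOn (X : TripleSystem V) (hX : X.IsSteiner) [Fintype V]
    [DecidableEq V] [Fintype X.blocks] {c a a' : V} (B₀ : X.blocks)
    (hB₀ : (B₀ : Finset V) = {c, a, a'})
    (hca : c ≠ a) (hca' : c ≠ a') (haa' : a ≠ a') (h : V → X.blocks)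
    (hh : ∀ x, x ∉ (B₀ : Finset V) → c ∉ (h x : Finset V) ∧ x ∈ (h x : Finset V) ∧
      (a ∈ (h x : Finset V) ∨ a' ∈ (h x : Finset V)))
    (hinj : ∀ x y, x ∉ (B₀ : Finset V) → y ∉ (B₀ : Finset V) → h x = h y → x = y)
    {x₀ : V} (hx₀ : x₀ ∉ (B₀ : Finset V)) (ha : a ∈ (h x₀ : Finset V)) :
    ∃ f : X.blocks → V, (∀ B : X.blocks, f B ∈ (B : Finset V)) ∧
      ∀ v, v ≠ c → Even (Finset.univ.filter fun B : X.blocks =>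
        c ∉ (B : Finset V) ∧ v ∈ (B : Finset V) ∧ f B ≠ v).card := by
  classical
  have hc0 : c ∈ (B₀ : Finset V) := by simp [hB₀]
  have ha0 : a ∈ (B₀ : Finset V) := by simp [hB₀]
  have ha0' : a' ∈ (B₀ : Finset V) := by simp [hB₀]
  -- A block off `c` does not contain both `a` and `a'`.
  have hnot : ∀ B : X.blocks, c ∉ (B : Finset V) → a ∈ (B : Finset V) → a' ∉ (B : Finset V) := by
    intro B hcB h1 h2
    rw [X.block_eq haa' h1 h2 ha0 ha0'] at hcB
    exact hcB hc0
  obtain ⟨hcE, hxE, -⟩ := hh x₀ hx₀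
  have hxa : x₀ ≠ a := by rintro rfl; exact hx₀ ha0
  obtain ⟨y, hya, hyx, hE⟩ := X.exists_eq_insert (h x₀).2 ha hxE hxa.symm
  have hyE : y ∈ (h x₀ : Finset V) := by rw [hE]; simp
  have hy : y ∉ (B₀ : Finset V) := by
    rw [hB₀]
    simp only [Finset.mem_insert, Finset.mem_singleton, not_or]
    refine ⟨?_, hya, ?_⟩ <;> rintro rfl
    exacts [hcE hyE, hnot _ hcE ha hyE]
  obtain ⟨hcE', hyE', haE'⟩ := hh y hy
  have hEE' : h x₀ ≠ h y := fun h => hyx (hinj _ _ hx₀ hy h).symm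
  have haE'n : a ∉ (h y : Finset V) := fun h1 => hEE' (X.block_eq hya hyE ha hyE' h1)
  have haE' : a' ∈ (h y : Finset V) := haE'.resolve_left haE'n
  have haEn : a' ∉ (h x₀ : Finset V) := hnot _ hcE ha
  choose any hany using X.nonempty_of_mem
  -- The choice in blocks disjoint from `{c, a, a'}`, and the number of these blocks at each point
  -- in which another point is chosen.
  let g : X.blocks → V := fun B =>
    if x₀ ∈ (B : Finset V) then x₀ else if y ∈ (B : Finset V) then y else any B
  let U : V → Finset X.blocks := fun z => Finset.univ.filter fun B : X.blocks =>
    (c ∉ (B : Finset V) ∧ a ∉ (B : Finset V) ∧ a' ∉ (B : Finset V)) ∧ z ∈ (B : Finset V) ∧ g B ≠ z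
  have hU : U x₀ = ∅ ∧ U y = ∅ := by
    constructor
    · refine Finset.filter_eq_empty_iff.2 fun B _ hB => hB.2.2 ?_
      simp only [g, hB.2.1, if_true]
    · refine Finset.filter_eq_empty_iff.2 fun B _ hB => hB.2.2 ?_
      have : x₀ ∉ (B : Finset V) := by
        intro hx
        have := X.block_eq hyx hB.2.1 hx hyE hxE
        exact hB.1.2.1 (this ▸ ha)
      simp only [g, hB.2.1, this, if_true, if_false]
  have hf : ∀ B : X.blocks, ∃ v ∈ (B : Finset V),
      ((c ∉ (B : Finset V) ∧ a ∉ (B : Finset V) ∧ a' ∉ (B : Finset V)) → v = g B) ∧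
      (c ∉ (B : Finset V) → (a ∈ (B : Finset V) ∨ a' ∈ (B : Finset V)) →
        (∀ z, z ∉ (B₀ : Finset V) → (v = z ↔ h z = B ∧ Odd (U z).card)) ∧
        ((∀ z, z ∉ (B₀ : Finset V) → h z = B → ¬ Odd (U z).card) → v = a ∨ v = a')) := by
    intro B
    by_cases h1 : a ∈ (B : Finset V) ∨ a' ∈ (B : Finset V)
    · by_cases h2 : ∃ z, z ∉ (B₀ : Finset V) ∧ h z = B ∧ Odd (U z).card
      · obtain ⟨z, hz, hzB, hzo⟩ := h2
        refine ⟨z, hzB ▸ (hh z hz).2.1, fun h3 => by tauto, fun _ _ => ⟨?_, ?_⟩⟩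
        · intro w hw
          constructor
          · rintro rfl; exact ⟨hzB, hzo⟩
          · rintro ⟨hw1, -⟩; exact hinj _ _ hz hw (hzB.trans hw1.symm)
        · intro h3; exact absurd hzo (h3 z hz hzB)
      · obtain ⟨v, hv, hva⟩ : ∃ v ∈ (B : Finset V), v = a ∨ v = a' := by
          rcases h1 with h1 | h1
          exacts [⟨a, h1, .inl rfl⟩, ⟨a', h1, .inr rfl⟩]
        refine ⟨v, hv, fun h3 => by tauto, fun _ _ => ⟨?_, fun _ => hva⟩⟩
        intro w hw
        refine iff_of_false ?_ fun h3 => h2 ⟨w, hw, h3⟩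
        rintro rfl
        rcases hva with rfl | rfl
        exacts [hw ha0, hw ha0']
    · refine ⟨g B, ?_, fun _ => rfl, fun _ h2 => absurd h2 h1⟩
      simp only [g]
      split_ifs <;> first | assumption | exact hany B
  choose f hfB hfg hfz using hf
  let C : (X.blocks → V) → V → Finset X.blocks := fun f v =>
    Finset.univ.filter fun B : X.blocks => c ∉ (B : Finset V) ∧ v ∈ (B : Finset V) ∧ f B ≠ v
  have hfE : f (h x₀) = a := by
    rcases (hfz (h x₀) hcE (.inl ha)).2 (by
      intro z hz hzx
      rw [hinj _ _ hz hx₀ hzx, hU.1]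
      simp) with h1 | h1
    · exact h1
    · exact absurd (h1 ▸ hfB (h x₀)) haEn
  have hfE' : f (h y) = a' := by
    rcases (hfz (h y) hcE' (.inr haE')).2 (by
      intro z hz hzx
      rw [hinj _ _ hz hy hzx, hU.2]
      simp) with h1 | h1
    · exact absurd (h1 ▸ hfB (h y)) haE'n
    · exact h1
  have hoff : ∀ z, z ∉ (B₀ : Finset V) → Even (C f z).card := by
    intro z hz
    let T : Finset X.blocks := Finset.univ.filter fun B : X.blocks =>
      c ∉ (B : Finset V) ∧ z ∈ (B : Finset V) ∧ (a ∈ (B : Finset V) ∨ a' ∈ (B : Finset V))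
    have hT : T.card = 2 := X.card_blocks_through hX B₀ hB₀ hca hca' haa' hz
    have hhT : h z ∈ T := Finset.mem_filter.2 ⟨Finset.mem_univ _, hh z hz⟩
    let T' : Finset X.blocks := if Odd (U z).card then T.erase (h z) else T
    have hCU : C f z = U z ∪ T' := by
      ext B
      rw [Finset.mem_union]
      by_cases hcB : c ∈ (B : Finset V)
      · simp only [C, U, T', T, Finset.mem_filter, hcB]
        split_ifs <;> simp [hcB]
      by_cases haB : a ∈ (B : Finset V) ∨ a' ∈ (B : Finset V)
      · have h1 := (hfz B hcB haB).1 z hz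
        have h2 : B ∉ U z := fun h => by
          have := (Finset.mem_filter.1 h).2.1
          tauto
        simp only [h2, false_or]
        simp only [C, T', T, Finset.mem_filter, Finset.mem_univ, true_and, ne_eq, h1]
        split_ifs with ho
        · simp [hcB, haB, ho, eq_comm, and_comm]
        · simp [hcB, haB, ho]
      · have haB' := not_or.1 haB
        have h1 := hfg B ⟨hcB, haB'⟩
        have h2 : B ∉ T' := by
          intro h
          have : B ∈ T := by
            simp only [T'] at h
            split_ifs at h
            exacts [Finset.mem_of_mem_erase h, h]
          exact haB (Finset.mem_filter.1 this).2.2.2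
        simp [C, U, h2, h1, hcB, haB'.1, haB'.2]
    have hdisj : Disjoint (U z) T' := by
      rw [Finset.disjoint_left]
      intro B h1 h
      have : B ∈ T := by
        simp only [T'] at h
        split_ifs at h
        exacts [Finset.mem_of_mem_erase h, h]
      have h2 := (Finset.mem_filter.1 this).2.2.2
      have h3 := (Finset.mem_filter.1 h1).2.1
      tauto
    rw [hCU, Finset.card_union_of_disjoint hdisj]
    simp only [T']
    split_ifs with ho
    · rw [Finset.card_erase_of_mem hhT, hT]
      exact ho.add_odd (by decide)
    · rw [hT]
      exact (Nat.not_odd_iff_even.1 ho).add (by decide)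
  have hsum : Even ((C f a).card + (C f a').card) := by
    have h1 := X.even_sum_card_not_chosen c f hfB
    have h2 : Even (∑ v ∈ (B₀ : Finset V)ᶜ, (C f v).card) :=
      Finset.even_sum _ fun v hv => hoff v (Finset.mem_compl.1 hv)
    have h3 : (C f c).card = 0 := by
      rw [Finset.card_eq_zero]
      exact Finset.filter_eq_empty_iff.2 fun B _ hB => hB.1 hB.2.1
    have h4 := Finset.sum_add_sum_compl (B₀ : Finset V) fun v => (C f v).card
    rw [hB₀, Finset.sum_insert (by simp [hca, hca']), Finset.sum_insert (by simp [haa']),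
      Finset.sum_singleton, h3, zero_add, ← hB₀] at h4
    have h5 : Even (∑ v, (C f v).card) := h1
    rw [← h4] at h5
    exact (Nat.even_add.1 h5).2 h2
  have hcases : ∀ v, v ≠ c → v = a ∨ v = a' ∨ v ∉ (B₀ : Finset V) := by
    intro v hv
    rw [hB₀]
    simp only [Finset.mem_insert, Finset.mem_singleton]
    tauto
  by_cases hev : Even (C f a).card
  · refine ⟨f, hfB, fun v hv => ?_⟩
    rcases hcases v hv with rfl | rfl | h1
    exacts [hev, (Nat.even_add.1 hsum).1 hev, hoff v h1]
  have hev' : ¬ Even (C f a').card := fun h1 => hev ((Nat.even_add.1 hsum).2 h1)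
  have hy' : y ≠ a' := by rintro rfl; exact hy ha0'
  let f' : X.blocks → V := fun B => if B = h x₀ ∨ B = h y then y else f B
  have hf'1 : f' (h x₀) = y := by simp [f']
  have hf'2 : f' (h y) = y := by simp [f']
  have hf'3 : ∀ B, B ≠ h x₀ → B ≠ h y → f' B = f B := by
    intro B h1 h2; simp [f', h1, h2]
  refine ⟨f', ?_, fun v hv => ?_⟩
  · intro B
    by_cases h1 : B = h x₀
    · rw [h1, hf'1]; exact hyE
    by_cases h2 : B = h y
    · rw [h2, hf'2]; exact hyE'
    rw [hf'3 B h1 h2]; exact hfB B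
  change Even (C f' v).card
  have mem : ∀ f v B, B ∈ C f v ↔ c ∉ (B : Finset V) ∧ v ∈ (B : Finset V) ∧ f B ≠ v := by
    intro f v B; simp [C]
  rcases hcases v hv with rfl | rfl | h1
  · have e : C f' v = insert (h x₀) (C f v) := by
      ext B
      rw [Finset.mem_insert, mem, mem]
      by_cases h1 : B = h x₀
      · subst h1; simp [hcE, ha, hf'1, hya]
      by_cases h2 : B = h y
      · subst h2; simp [haE'n, h1]
      simp [hf'3 B h1 h2, h1]
    have hn : h x₀ ∉ C f v := by rw [mem]; simp [hfE]
    rw [e, Finset.card_insert_of_notMem hn]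
    exact (Nat.not_even_iff_odd.1 hev).add_odd (by decide)
  · have e : C f' v = insert (h y) (C f v) := by
      ext B
      rw [Finset.mem_insert, mem, mem]
      by_cases h2 : B = h y
      · subst h2; simp [hcE', haE', hf'2, hy']
      by_cases h1 : B = h x₀
      · subst h1; simp [haEn, h2]
      simp [hf'3 B h1 h2, h2]
    have hn : h y ∉ C f v := by rw [mem]; simp [hfE']
    rw [e, Finset.card_insert_of_notMem hn]
    exact (Nat.not_even_iff_odd.1 hev').add_odd (by decide)
  · have hva : a ≠ v := by rintro rfl; exact h1 ha0
    have hva' : a' ≠ v := by rintro rfl; exact h1 ha0'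
    by_cases hvy : v = y
    · subst hvy
      have e : C f v = insert (h x₀) (insert (h v) (C f' v)) := by
        ext B
        rw [Finset.mem_insert, Finset.mem_insert, mem, mem]
        by_cases h1 : B = h x₀
        · subst h1; simp [hcE, hyE, hfE, hva]
        by_cases h2 : B = h v
        · subst h2; simp [hcE', hyE', hfE', hva']
        simp [hf'3 B h1 h2, h1, h2]
      have hn1 : h v ∉ C f' v := by rw [mem]; simp [hf'2]
      have hn2 : h x₀ ∉ insert (h v) (C f' v) := by
        rw [Finset.mem_insert, mem]; simp [hf'1, hEE']
      have := hoff v h1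
      rw [e, Finset.card_insert_of_notMem hn2, Finset.card_insert_of_notMem hn1] at this
      grind
    · have e : C f' v = C f v := by
        ext B
        rw [mem, mem]
        by_cases h1 : B = h x₀
        · subst h1; simp [hf'1, hfE, hva, Ne.symm hvy]
        by_cases h2 : B = h y
        · subst h2; simp [hf'2, hfE', hva', Ne.symm hvy]
        rw [hf'3 B h1 h2]
      rw [e]
      exact hoff v h1

/-- In a Steiner triple system one can choose a point in every block so that each point `v ≠ c` lies
in an even number of blocks off `c` in which another point is chosen. -/
theorem exists_even_choice (X : TripleSystem V) (hX : X.IsSteiner) [Finite V] (c : V) :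
    ∃ f : X.blocks → V, (∀ B : X.blocks, f B ∈ (B : Finset V)) ∧
      ∀ v, v ≠ c → Even {B : X.blocks |
        c ∉ (B : Finset V) ∧ v ∈ (B : Finset V) ∧ f B ≠ v}.ncard := by
  classical
  have := Fintype.ofFinite V
  have := Fintype.ofFinite X.blocks
  by_cases hN : ∃ B : X.blocks, c ∉ (B : Finset V)
  · obtain ⟨B, hcB⟩ := hN
    obtain ⟨b, hb⟩ := X.nonempty_of_mem B
    have hcb : c ≠ b := by rintro rfl; exact hcB hb
    obtain ⟨B₀, hB₀, hc0, hb0⟩ := hX c b hcb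
    obtain ⟨d, hdc, hdb, hB₀'⟩ := X.exists_eq_insert hB₀ hc0 hb0 hcb
    obtain ⟨h, hh, hinj⟩ := X.exists_injOn_block hX ⟨B₀, hB₀⟩ hB₀' hcb hdc.symm hdb.symm
    obtain ⟨x₀, -, hx₀⟩ : ∃ x ∈ (B : Finset V), x ∉ B₀ := by
      by_contra hcon
      push Not at hcon
      have := Finset.eq_of_subset_of_card_le (s := (B : Finset V)) (t := B₀) hcon
        (by rw [X.card_eq_three B B.2, X.card_eq_three B₀ hB₀])
      exact hcB (this ▸ hc0)
    obtain ⟨f, hf, hfe⟩ : ∃ f : X.blocks → V, (∀ B : X.blocks, f B ∈ (B : Finset V)) ∧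
        ∀ v, v ≠ c → Even (Finset.univ.filter fun B : X.blocks =>
          c ∉ (B : Finset V) ∧ v ∈ (B : Finset V) ∧ f B ≠ v).card := by
      rcases (hh x₀ hx₀).2.2 with h1 | h1
      · exact X.exists_even_choice_of_injOn hX ⟨B₀, hB₀⟩ hB₀' hcb hdc.symm hdb.symm h hh hinj hx₀ h1
      · exact X.exists_even_choice_of_injOn hX ⟨B₀, hB₀⟩
          (hB₀'.trans (by rw [Finset.pair_comm])) hdc.symm hcb hdb h
          (fun x hx => ⟨(hh x hx).1, (hh x hx).2.1, (hh x hx).2.2.symm⟩) hinj hx₀ h1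
    refine ⟨f, hf, fun v hv => ?_⟩
    have := hfe v hv
    rwa [← Set.ncard_coe_finset, Finset.coe_filter_univ] at this
  · push Not at hN
    choose f hf using X.nonempty_of_mem
    refine ⟨f, hf, fun v _ => ?_⟩
    have : {B : X.blocks | c ∉ (B : Finset V) ∧ v ∈ (B : Finset V) ∧ f B ≠ v} = ∅ := by
      ext B; simp [hN B]
    rw [this]; simp

end TripleSystem

/-! ### Rotations of the flags of a Steiner triple system -/

namespace TripleSystem

variable {V : Type*}

/-- The flags of a triple system: pairs of a block and a point of that block. -/
def Flag (X : TripleSystem V) : Type _ :=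
  {p : V × X.blocks // p.1 ∈ (p.2 : Finset V)}

namespace Flag

variable {X : TripleSystem V}

/-- The point of a flag. -/
def point (q : X.Flag) : V := q.1.1

/-- The block of a flag. -/
def block (q : X.Flag) : X.blocks := q.1.2

theorem point_mem (q : X.Flag) : q.point ∈ (q.block : Finset V) := q.2

theorem ext {p q : X.Flag} (h1 : p.point = q.point) (h2 : p.block = q.block) : p = q :=
  Subtype.ext (Prod.ext h1 h2)

/-- The flag of the point `v` and the block `B`. -/
def mk (v : V) (B : X.blocks) (h : v ∈ (B : Finset V)) : X.Flag := ⟨(v, B), h⟩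

instance [Finite V] : Finite X.Flag :=
  inferInstanceAs (Finite {p : V × X.blocks // p.1 ∈ (p.2 : Finset V)})

end Flag

/-- The blocks through `c`, joined at `c`, and every other block `B`, joined at its point `f B` to
the block through `f B` and `c`, form a tree that gives a one-face map. -/
theorem exists_isTreeRotation (X : TripleSystem V) (hX : X.IsSteiner) [Finite V]
    [DecidableEq X.Flag] (τ : Equiv.Perm X.Flag) (hτ : ∀ q, (τ q).block = q.block)
    (hτ' : ∀ p q : X.Flag, p.block = q.block → τ.SameCycle p q) (B₀ : X.blocks) (c : V)
    (hc : c ∈ (B₀ : Finset V)) (f : X.blocks → V) (hf : ∀ B : X.blocks, f B ∈ (B : Finset V)) :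
    ∃ ρ, IsTreeRotation τ Flag.point Flag.block
      {q | c ∈ (q.block : Finset V) ∨ q.point = f q.block} Set.univ ρ := by
  classical
  have := Fintype.ofFinite X.blocks
  have hinj : ∀ p q : X.Flag, p.point = q.point → p.block = q.block → p = q :=
    fun _ _ => Flag.ext
  let A : Set X.Flag := {q | c ∈ (q.block : Finset V) ∨ q.point = f q.block}
  have star : ∀ S : Finset X.blocks, (∀ B ∈ S, c ∈ (B : Finset V)) →
      ∃ ρ, IsTreeRotation τ Flag.point Flag.block A (insert B₀ (S : Set X.blocks)) ρ := by
    intro S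
    induction S using Finset.induction_on with
    | empty =>
      intro _
      refine ⟨1, fun _ _ => rfl, fun _ _ => rfl, fun _ => rfl, ?_, ?_, ?_⟩
      · intro p q _ _ hp hq hpq
        simp only [Finset.coe_empty, insert_empty_eq, Set.mem_singleton_iff] at hp hq
        rw [Flag.ext hpq (hp.trans hq.symm)]
      · intro p q hpq
        rw [one_mul]
        exact hτ' p q hpq
      · intro p q hp hq
        simp only [Finset.coe_empty, insert_empty_eq, Set.mem_singleton_iff] at hp hq
        rw [one_mul]
        exact hτ' p q (hp.trans hq.symm)
    | insert B S hBS ih =>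
      intro hS
      obtain ⟨ρ, hρ⟩ := ih fun B hB => hS B (Finset.mem_insert_of_mem hB)
      have hcB := hS B (Finset.mem_insert_self _ _)
      have hSc : ∀ C ∈ insert B₀ (S : Set X.blocks), c ∈ (C : Finset V) := by
        rintro C (rfl | hC)
        exacts [hc, hS C (Finset.mem_insert_of_mem hC)]
      rw [Finset.coe_insert, Set.insert_comm]
      by_cases hBK : B ∈ insert B₀ (S : Set X.blocks)
      · rw [Set.insert_eq_of_mem hBK]
        exact ⟨ρ, hρ⟩
      refine ⟨_, hρ.insert hτ hinj (s := Flag.mk c B₀ hc) (p := Flag.mk c B hcB) (.inl hcB)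
        (.inl hc) hBK (Set.mem_insert _ _) rfl ?_⟩
      intro q _ hqB
      by_cases hqc : q.point = c
      · exact .inl (Flag.ext hqc hqB)
      refine .inr fun r _ hr hrq => hBK ?_
      have h1 : r.block = B := X.block_eq hqc (hrq ▸ r.point_mem) (hSc _ hr)
        ((show q.block = B from hqB) ▸ q.point_mem) hcB
      exact h1 ▸ hr
  have rest : ∀ S : Finset X.blocks,
      ∃ ρ, IsTreeRotation τ Flag.point Flag.block A ({B | c ∈ (B : Finset V)} ∪ S) ρ := by
    intro S
    induction S using Finset.induction_on with
    | empty =>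
      obtain ⟨ρ, hρ⟩ := star (Finset.univ.filter fun B : X.blocks => c ∈ (B : Finset V)) (by simp)
      refine ⟨ρ, ?_⟩
      convert hρ using 1
      ext B
      simp only [Finset.coe_empty, Set.union_empty, Finset.coe_filter_univ, Set.mem_insert_iff,
        Set.mem_ofPred_eq]
      refine ⟨.inr, ?_⟩
      rintro (rfl | h)
      exacts [hc, h]
    | insert B S hBS ih =>
      obtain ⟨ρ, hρ⟩ := ih
      rw [Finset.coe_insert, Set.union_insert]
      by_cases hBK : B ∈ {B : X.blocks | c ∈ (B : Finset V)} ∪ (S : Set X.blocks)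
      · rw [Set.insert_eq_of_mem hBK]
        exact ⟨ρ, hρ⟩
      have hcB : c ∉ (B : Finset V) := fun h => hBK (.inl h)
      have hcf : c ≠ f B := fun h => hcB (h ▸ hf B)
      obtain ⟨C, hC, hcC, hfC⟩ := hX c (f B) hcf
      refine ⟨_, hρ.insert hτ hinj (s := Flag.mk (f B) ⟨C, hC⟩ hfC) (p := Flag.mk (f B) B (hf B))
        (.inr rfl) (.inl hcC) hBK (.inl hcC) rfl ?_⟩
      intro q hq hqB
      have hqB : q.block = B := hqB
      refine .inl (Flag.ext ?_ hqB)
      rcases hq with h1 | h1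
      · exact absurd (hqB ▸ h1) hcB
      · rw [h1, hqB]; rfl
  obtain ⟨ρ, hρ⟩ := rest Finset.univ
  refine ⟨ρ, ?_⟩
  rwa [Finset.coe_univ, Set.union_univ] at hρ

/-- For any cyclic permutations of the points of each block, the flags at each point of a Steiner
triple system have a cyclic order so that the flags lie along a single face. -/
theorem exists_rotation (X : TripleSystem V) (hX : X.IsSteiner) [Finite V]
    (τ : Equiv.Perm X.Flag) (hτ : ∀ q, (τ q).block = q.block)
    (hτ' : ∀ p q : X.Flag, p.block = q.block → τ.SameCycle p q) (B₀ : X.blocks) :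
    ∃ ρ : Equiv.Perm X.Flag, (∀ q, (ρ q).point = q.point) ∧
      (∀ p q : X.Flag, p.point = q.point → ρ.SameCycle p q) ∧
      ∀ p q, (ρ * τ).SameCycle p q := by
  classical
  have := Fintype.ofFinite X.Flag
  obtain ⟨c, hc⟩ := X.nonempty_of_mem B₀
  obtain ⟨f, hf, heven⟩ := X.exists_even_choice hX c
  obtain ⟨ρ, hρ⟩ := X.exists_isTreeRotation hX τ hτ hτ' B₀ c hc f hf
  have hC : ∀ q : X.Flag, q ∈ (Finset.univ.filter fun q : X.Flag =>
      ¬ (c ∈ (q.block : Finset V) ∨ q.point = f q.block)) ↔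
      ¬ (c ∈ (q.block : Finset V) ∨ q.point = f q.block) := by
    intro q; simp
  refine exists_rotation_of_even τ Flag.point (Finset.univ.filter fun q : X.Flag =>
      ¬ (c ∈ (q.block : Finset V) ∨ q.point = f q.block)) ρ ?_ hρ.point ?_
      (fun a b => hρ.face a b (Set.mem_univ _) (Set.mem_univ _)) ?_ ?_
  · intro q hq
    exact hρ.fix_of_flag q ((hC q).1 hq)
  · intro p q hp hq hpq
    rw [hC, not_not] at hp hq
    exact hρ.sameCycle p q hp hq (Set.mem_univ _) (Set.mem_univ _) hpq
  · intro q
    by_cases hq : q.point = c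
    · exact ⟨q, by rw [hC, not_not]; exact .inl (hq ▸ q.point_mem), rfl⟩
    obtain ⟨B, hB, hqB, hcB⟩ := hX q.point c hq
    exact ⟨Flag.mk q.point ⟨B, hB⟩ hqB, by rw [hC, not_not]; exact .inl hcB, rfl⟩
  · intro v
    have hv' : {q ∈ ((Finset.univ.filter fun q : X.Flag =>
        ¬ (c ∈ (q.block : Finset V) ∨ q.point = f q.block) : Finset X.Flag) : Set X.Flag) |
        q.point = v} =
        {q | (c ∉ (q.block : Finset V) ∧ q.point ≠ f q.block) ∧ q.point = v} := by
      ext q; simp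
    rw [hv']
    by_cases hv : v = c
    · have : {q : X.Flag | (c ∉ (q.block : Finset V) ∧ q.point ≠ f q.block) ∧ q.point = v} = ∅ :=
        Set.eq_empty_of_forall_notMem fun q h => h.1.1 (hv ▸ h.2 ▸ q.point_mem)
      rw [this]; simp
    · rw [← Set.InjOn.ncard_image (f := Flag.block)]
      · convert heven v hv using 2
        ext B
        constructor
        · rintro ⟨q, ⟨⟨h1, h2⟩, rfl⟩, rfl⟩
          exact ⟨h1, q.point_mem, Ne.symm h2⟩
        · rintro ⟨h1, h2, h3⟩
          exact ⟨Flag.mk v B h2, ⟨⟨h1, Ne.symm h3⟩, rfl⟩, rfl⟩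
      · intro p hp q hq hpq
        exact Flag.ext (hp.2.trans hq.2.symm) hpq

end TripleSystem

/-! ### From rotations of the flags to embeddings -/

namespace TripleSystem

variable {V : Type*} {X : TripleSystem V} {o : X.blocks → Equiv.Perm V}

namespace IsOrientation

theorem apply_mem (ho : X.IsOrientation o) {B : X.blocks} {v : V} (hv : v ∈ (B : Finset V)) :
    o B v ∈ (B : Finset V) := by
  rw [← (ho B).2] at hv ⊢
  exact fun h => hv ((o B).injective h)

theorem symm_apply_mem (ho : X.IsOrientation o) {B : X.blocks} {v : V}
    (hv : v ∈ (B : Finset V)) : (o B).symm v ∈ (B : Finset V) := by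
  rw [← (ho B).2] at hv ⊢
  rw [Equiv.apply_symm_apply]
  intro h
  exact hv (by rw [← Equiv.eq_symm_apply]; exact h)

theorem apply_ne (ho : X.IsOrientation o) {B : X.blocks} {v : V} (hv : v ∈ (B : Finset V)) :
    o B v ≠ v :=
  ((ho B).2 v).2 hv

theorem symm_apply_ne (ho : X.IsOrientation o) {B : X.blocks} {v : V} (hv : v ∈ (B : Finset V)) :
    (o B).symm v ≠ v := by
  intro h
  exact ho.apply_ne hv (by rw [← Equiv.eq_symm_apply]; exact h.symm)

/-- A block has three points, so that its cyclic permutation is not an involution. -/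
theorem symm_apply_ne_apply (ho : X.IsOrientation o) {B : X.blocks} {v : V}
    (hv : v ∈ (B : Finset V)) : (o B).symm v ≠ o B v := by
  classical
  intro h
  have h2 : o B (o B v) = v := by rw [← h, Equiv.apply_symm_apply]
  obtain ⟨z, hz1, hz2, hB⟩ := X.exists_eq_insert B.2 hv (ho.apply_mem hv) (ho.apply_ne hv).symm
  have hz : z ∈ (B : Finset V) := by rw [hB]; simp
  obtain ⟨i, hi⟩ := (ho B).1.sameCycle (ho.apply_ne hv) (ho.apply_ne hz)
  have key : ∀ i : ℤ, ((o B ^ i) v = v ∨ (o B ^ i) v = o B v) := by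
    intro i
    rcases Int.even_or_odd' i with ⟨k, rfl | rfl⟩
    · left
      rw [zpow_mul]
      exact Equiv.Perm.zpow_apply_eq_self_of_apply_eq_self
        (by rw [zpow_ofNat, pow_two, Equiv.Perm.mul_apply, h2]) k
    · right
      rw [add_comm, zpow_add, zpow_mul, Equiv.Perm.mul_apply,
        Equiv.Perm.zpow_apply_eq_self_of_apply_eq_self
          (by rw [zpow_ofNat, pow_two, Equiv.Perm.mul_apply, h2]) k, zpow_one]
  rcases key i with h3 | h3
  exacts [hz1 (hi.symm.trans h3), hz2 (hi.symm.trans h3)]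

/-- The permutation of the flags that follows the prescribed cyclic permutation in each block. -/
def flagPerm (ho : X.IsOrientation o) : Equiv.Perm X.Flag where
  toFun q := Flag.mk (o q.block q.point) q.block (ho.apply_mem q.point_mem)
  invFun q := Flag.mk ((o q.block).symm q.point) q.block (ho.symm_apply_mem q.point_mem)
  left_inv q := Flag.ext ((o q.block).symm_apply_apply q.point) rfl
  right_inv q := Flag.ext ((o q.block).apply_symm_apply q.point) rfl

theorem sameCycle_flagPerm [Finite V] (ho : X.IsOrientation o) {p q : X.Flag}
    (h : p.block = q.block) : ho.flagPerm.SameCycle p q := by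
  obtain ⟨i, hi⟩ := ((ho p.block).1.sameCycle (ho.apply_ne p.point_mem)
    (ho.apply_ne (h ▸ q.point_mem))).exists_nat_pow_eq
  have key : ∀ n : ℕ, ((ho.flagPerm ^ n) p).block = p.block ∧
      ((ho.flagPerm ^ n) p).point = (o p.block ^ n) p.point := by
    intro n
    induction n with
    | zero => exact ⟨rfl, rfl⟩
    | succ n ih =>
      rw [pow_succ', pow_succ', Equiv.Perm.mul_apply, Equiv.Perm.mul_apply, ← ih.2]
      refine ⟨ih.1, ?_⟩
      conv_rhs => rw [← ih.1]
      rfl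
  refine ⟨i, ?_⟩
  rw [zpow_natCast]
  exact Flag.ext ((key i).2.trans hi) ((key i).1.trans h)

/-- The dart along the prescribed cyclic permutation of the block of a flag that starts at the
point of the flag. -/
def forward (ho : X.IsOrientation o) (q : X.Flag) : X.graph.Dart :=
  ⟨(q.point, o q.block q.point), (ho.apply_ne q.point_mem).symm, q.block, q.block.2, q.point_mem,
    ho.apply_mem q.point_mem⟩

/-- The dart against the prescribed cyclic permutation of the block of a flag that starts at the
point of the flag. -/
def backward (ho : X.IsOrientation o) (q : X.Flag) : X.graph.Dart :=
  ⟨(q.point, (o q.block).symm q.point), (ho.symm_apply_ne q.point_mem).symm, q.block, q.block.2,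
    q.point_mem, ho.symm_apply_mem q.point_mem⟩

theorem symm_forward (ho : X.IsOrientation o) (q : X.Flag) :
    (ho.forward q).symm = ho.backward (ho.flagPerm q) :=
  SimpleGraph.Dart.ext _ _ (Prod.ext rfl ((o q.block).symm_apply_apply q.point).symm)

theorem symm_backward (ho : X.IsOrientation o) (q : X.Flag) :
    (ho.backward q).symm = ho.forward (ho.flagPerm.symm q) :=
  SimpleGraph.Dart.ext _ _ (Prod.ext rfl ((o q.block).apply_symm_apply q.point).symm)

theorem forward_injective (ho : X.IsOrientation o) : Function.Injective ho.forward := by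
  intro p q h
  have h1 : p.point = q.point := congrArg (fun d => d.fst) h
  have h2 : o p.block p.point = o q.block q.point := congrArg (fun d => d.snd) h
  exact Flag.ext h1 (X.block_eq (ho.apply_ne p.point_mem) (ho.apply_mem p.point_mem) p.point_mem
    (h2 ▸ ho.apply_mem q.point_mem) (h1 ▸ q.point_mem))

theorem backward_injective (ho : X.IsOrientation o) : Function.Injective ho.backward := by
  intro p q h
  have := congrArg SimpleGraph.Dart.symm h
  rw [symm_backward, symm_backward] at this
  exact ho.flagPerm.symm.injective (ho.forward_injective this)

theorem forward_ne_backward (ho : X.IsOrientation o) (p q : X.Flag) :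
    ho.forward p ≠ ho.backward q := by
  intro h
  have h1 : p.point = q.point := congrArg (fun d => d.fst) h
  have h2 : o p.block p.point = (o q.block).symm q.point := congrArg (fun d => d.snd) h
  have h3 : p.block = q.block :=
    X.block_eq (ho.apply_ne p.point_mem) (ho.apply_mem p.point_mem) p.point_mem
      (h2 ▸ ho.symm_apply_mem q.point_mem) (h1 ▸ q.point_mem)
  rw [h1, h3] at h2
  exact ho.symm_apply_ne_apply q.point_mem h2.symm

theorem exists_forward_or_backward (ho : X.IsOrientation o) (d : X.graph.Dart) :
    (∃ q, ho.forward q = d) ∨ ∃ q, ho.backward q = d := by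
  classical
  obtain ⟨⟨u, v⟩, hne, B, hB, hu, hv⟩ := d
  have hu : u ∈ B := hu
  have hv : v ∈ B := hv
  have hne : u ≠ v := hne
  let C : X.blocks := ⟨B, hB⟩
  have hu' : u ∈ (C : Finset V) := hu
  obtain ⟨z, hz1, hz2, hBz⟩ := X.exists_eq_insert C.2 hu' (ho.apply_mem hu')
    (ho.apply_ne hu').symm
  have hsz : (o C).symm u = z := by
    have := ho.symm_apply_mem hu'
    rw [hBz] at this
    simp only [Finset.mem_insert, Finset.mem_singleton] at this
    rcases this with h | h | h
    exacts [absurd h (ho.symm_apply_ne hu'), absurd h (ho.symm_apply_ne_apply hu'), h]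
  have hv' : v ∈ (C : Finset V) := hv
  rw [hBz] at hv'
  simp only [Finset.mem_insert, Finset.mem_singleton] at hv'
  rcases hv' with h | h | h
  · exact absurd h.symm hne
  · exact .inl ⟨Flag.mk u C hu', SimpleGraph.Dart.ext _ _ (Prod.ext rfl h.symm)⟩
  · exact .inr ⟨Flag.mk u C hu', SimpleGraph.Dart.ext _ _ (Prod.ext rfl (hsz.trans h.symm))⟩

/-- Every flag has a forward and a backward dart, and these are all the darts. -/
noncomputable def dartEquiv (ho : X.IsOrientation o) : X.Flag ⊕ X.Flag ≃ X.graph.Dart :=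
  Equiv.ofBijective (Sum.elim ho.forward ho.backward) (by
    constructor
    · exact ho.forward_injective.sumElim ho.backward_injective ho.forward_ne_backward
    · intro d
      rcases ho.exists_forward_or_backward d with ⟨q, hq⟩ | ⟨q, hq⟩
      exacts [⟨.inl q, hq⟩, ⟨.inr q, hq⟩])

/-- The rotation of the darts in which the backward and the forward dart of each flag are
consecutive, and the pairs at each point follow the rotation `ρ` of the flags. -/
noncomputable def dartRotation (ho : X.IsOrientation o) (ρ : Equiv.Perm X.Flag) :
    Equiv.Perm X.graph.Dart :=
  ho.dartEquiv.permCongr ((Equiv.sumComm X.Flag X.Flag).trans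
    (Equiv.sumCongr (Equiv.refl X.Flag) ρ))

theorem dartRotation_forward (ho : X.IsOrientation o) (ρ : Equiv.Perm X.Flag) (q : X.Flag) :
    ho.dartRotation ρ (ho.forward q) = ho.backward (ρ q) := by
  have : ho.dartEquiv.symm (ho.forward q) = .inl q := by
    rw [Equiv.symm_apply_eq]; rfl
  rw [dartRotation, Equiv.permCongr_apply, this]
  rfl

theorem dartRotation_backward (ho : X.IsOrientation o) (ρ : Equiv.Perm X.Flag) (q : X.Flag) :
    ho.dartRotation ρ (ho.backward q) = ho.forward q := by
  have : ho.dartEquiv.symm (ho.backward q) = .inr q := by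
    rw [Equiv.symm_apply_eq]; rfl
  rw [dartRotation, Equiv.permCongr_apply, this]
  rfl

variable [Finite V]

theorem dartRotation_sameCycle (ho : X.IsOrientation o) {ρ : Equiv.Perm X.Flag}
    (hρ : ∀ p q : X.Flag, p.point = q.point → ρ.SameCycle p q) (d e : X.graph.Dart)
    (hde : d.fst = e.fst) : (ho.dartRotation ρ).SameCycle d e := by
  have hb : ∀ q, (ho.dartRotation ρ).SameCycle (ho.backward q) (ho.forward q) := by
    intro q
    have := Equiv.Perm.sameCycle_apply_self (ho.dartRotation ρ) (ho.backward q)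
    rwa [dartRotation_backward] at this
  have hs : ∀ q, (ho.dartRotation ρ).SameCycle (ho.forward q) (ho.forward (ρ q)) := by
    intro q
    have := Equiv.Perm.sameCycle_apply_self (ho.dartRotation ρ) (ho.forward q)
    rw [dartRotation_forward] at this
    exact this.trans (hb _)
  have hd : ∀ d : X.graph.Dart, ∃ q : X.Flag, q.point = d.fst ∧
      (ho.dartRotation ρ).SameCycle d (ho.forward q) := by
    intro d
    rcases ho.exists_forward_or_backward d with ⟨q, rfl⟩ | ⟨q, rfl⟩
    exacts [⟨q, rfl, .rfl⟩, ⟨q, rfl, hb q⟩]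
  obtain ⟨p, hp, hdp⟩ := hd d
  obtain ⟨q, hq, heq⟩ := hd e
  have hpq : (ho.dartRotation ρ).SameCycle (ho.forward p) (ho.forward q) :=
    (hρ p q (by rw [hp, hq, hde])).rel
      (r := fun p q => (ho.dartRotation ρ).SameCycle (ho.forward p) (ho.forward q))
      (fun _ => .rfl) (fun _ _ _ => .trans) hs
  exact (hdp.trans hpq).trans heq.symm

/-- The embedding given by a rotation of the flags. -/
noncomputable def embedding (ho : X.IsOrientation o) (hconn : X.graph.Connected)
    {ρ : Equiv.Perm X.Flag} (hpt : ∀ q, (ρ q).point = q.point)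
    (hρ : ∀ p q : X.Flag, p.point = q.point → ρ.SameCycle p q) : CellularEmbedding X.graph where
  connected := hconn
  rot := ho.dartRotation ρ
  rot_fst d := by
    rcases ho.exists_forward_or_backward d with ⟨q, rfl⟩ | ⟨q, rfl⟩
    · rw [dartRotation_forward]; exact hpt q
    · rw [dartRotation_backward]; rfl
  rot_sameCycle := ho.dartRotation_sameCycle hρ

/-- The forward darts are traced along the blocks, and the backward darts along `ρ` and the inverse
cyclic permutations of the blocks; so there is one face for each block and, where the latter have a
single orbit, one further face. -/
theorem isUpperEmbedding_embedding (ho : X.IsOrientation o) (hconn : X.graph.Connected)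
    {ρ : Equiv.Perm X.Flag} (hpt : ∀ q, (ρ q).point = q.point)
    (hρ : ∀ p q : X.Flag, p.point = q.point → ρ.SameCycle p q)
    (hface : ∀ p q, (ρ * ho.flagPerm.symm).SameCycle p q) [Nonempty X.Flag]
    (hiso : ∀ v : V, ∃ w, X.graph.Adj v w) :
    X.IsUpperEmbedding o (ho.embedding hconn hpt hρ) := by
  set M := ho.embedding hconn hpt hρ with hM
  have : Finite X.graph.Dart := Finite.of_equiv _ ho.dartEquiv
  have hfw : ∀ q, M.facePerm (ho.forward q) = ho.forward (ho.flagPerm q) := by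
    intro q
    change ho.dartRotation ρ (ho.forward q).symm = _
    rw [symm_forward, dartRotation_backward]
  have hbw : ∀ q, M.facePerm (ho.backward q) = ho.backward ((ρ * ho.flagPerm.symm) q) := by
    intro q
    change ho.dartRotation ρ (ho.backward q).symm = _
    rw [symm_backward, dartRotation_forward]
    rfl
  -- Faces of blocks consist of the forward darts of that block.
  have hblock : ∀ q d, M.facePerm.SameCycle (ho.forward q) d ↔
      ∃ q', q'.block = q.block ∧ ho.forward q' = d := by
    intro q d
    constructor
    · intro h
      refine h.rel (r := fun x y => (∃ q' : X.Flag, q'.block = q.block ∧ ho.forward q' = x) →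
        ∃ q' : X.Flag, q'.block = q.block ∧ ho.forward q' = y) (fun _ h => h)
        (fun _ _ _ h1 h2 h => h2 (h1 h)) ?_ ⟨q, rfl, rfl⟩
      rintro _ ⟨q', hq', rfl⟩
      exact ⟨ho.flagPerm q', hq', (hfw q').symm⟩
    · rintro ⟨q', hq', rfl⟩
      refine (ho.sameCycle_flagPerm hq'.symm).rel
        (r := fun x y => M.facePerm.SameCycle (ho.forward x) (ho.forward y))
        (fun _ => .rfl) (fun _ _ _ => .trans) fun x => ?_
      rw [← hfw]
      exact Equiv.Perm.sameCycle_apply_self _ _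
  have hback : ∀ p q, M.facePerm.SameCycle (ho.backward p) (ho.backward q) := by
    intro p q
    refine (hface p q).rel
      (r := fun x y => M.facePerm.SameCycle (ho.backward x) (ho.backward y))
      (fun _ => .rfl) (fun _ _ _ => .trans) fun x => ?_
    rw [← hbw]
    exact Equiv.Perm.sameCycle_apply_self _ _
  let face : X.graph.Dart → M.Face := fun d =>
    Sum.inl (Quotient.mk (Equiv.Perm.SameCycle.setoid M.facePerm) d)
  have mem : ∀ d e, d ∈ (face e).darts ↔ M.facePerm.SameCycle d e :=
    fun d e => Quotient.eq (r := Equiv.Perm.SameCycle.setoid M.facePerm)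
  have face_eq : ∀ d e, M.facePerm.SameCycle d e → face d = face e :=
    fun d e h => congrArg Sum.inl (Quotient.sound h)
  have hbound : ∀ q, CellularEmbedding.IsBoundedBy (face (ho.forward q)) (o q.block) := by
    intro q
    refine ⟨fun u hu => ?_, fun d => ?_⟩
    · have hu' := ((ho q.block).2 u).1 hu
      exact ⟨hu.symm, q.block, q.block.2, hu', ho.apply_mem hu'⟩
    · rw [mem, Equiv.Perm.sameCycle_comm, hblock]
      constructor
      · rintro ⟨q', hq', rfl⟩
        rw [← hq']; rfl
      · intro h
        have hd : d.fst ∈ (q.block : Finset V) :=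
          ((ho q.block).2 _).1 fun h' => d.fst_ne_snd (h'.symm.trans h)
        exact ⟨Flag.mk d.fst q.block hd, rfl, SimpleGraph.Dart.ext _ _ (Prod.ext rfl h)⟩
  have hout : ∀ q B, ¬ CellularEmbedding.IsBoundedBy (face (ho.backward q)) (o B) := by
    intro q B hB
    have h1 : o B q.point = (o q.block).symm q.point :=
      (hB.2 (ho.backward q)).1 ((mem _ _).2 .rfl)
    have hq : q.point ∈ (B : Finset V) :=
      ((ho B).2 _).1 (h1 ▸ ho.symm_apply_ne q.point_mem)
    exact ho.forward_ne_backward (Flag.mk q.point B hq) q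
      (SimpleGraph.Dart.ext _ _ (Prod.ext rfl h1))
  refine ⟨fun B => ?_, ?_⟩
  · obtain ⟨v, hv⟩ := X.nonempty_of_mem B
    exact ⟨_, hbound (Flag.mk v B hv)⟩
  · obtain ⟨q⟩ := ‹Nonempty X.Flag›
    refine ⟨face (ho.backward q), hout q, ?_⟩
    rintro (F | ⟨v, hv⟩) hF
    · induction F using Quotient.inductionOn with
      | h d =>
      rcases ho.exists_forward_or_backward d with ⟨p, rfl⟩ | ⟨p, rfl⟩
      · exact absurd (hbound p) (hF p.block)
      · exact face_eq _ _ (hback p q)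
    · obtain ⟨w, hw⟩ := hiso v
      exact absurd hw (hv w)

end IsOrientation

end TripleSystem

theorem theorem1 {V : Type*} [Finite V] [Nonempty V] (X : TripleSystem V) (hX : X.IsSteiner) :
    X.UpperEmbeddableInEveryOrientation := by
  intro o ho
  have hconn : X.graph.Connected := by
    rw [X.graph_eq_top_iff.2 hX]
    exact SimpleGraph.connected_top
  rcases subsingleton_or_nontrivial V with hV | hV
  · -- The embedding of a single point: no blocks, no darts, and one face.
    have hB : IsEmpty X.blocks := ⟨fun B => by
      have h1 := X.card_eq_three B B.2
      have h2 := Finset.card_le_one_of_subsingleton (B : Finset V)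
      omega⟩
    have hD : IsEmpty X.graph.Dart := ⟨fun d => d.fst_ne_snd (Subsingleton.elim _ _)⟩
    obtain ⟨v⟩ := ‹Nonempty V›
    refine ⟨⟨hconn, 1, fun _ => rfl, fun d => isEmptyElim d⟩, fun B => isEmptyElim B, ?_⟩
    refine ⟨.inr ⟨v, fun w h => h.1 (Subsingleton.elim _ _)⟩, fun B => isEmptyElim B, ?_⟩
    rintro (F | ⟨w, hw⟩) -
    · induction F using Quotient.inductionOn with
      | h d => exact isEmptyElim d
    · exact congrArg Sum.inr (Subtype.ext (Subsingleton.elim _ _))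
  · have hiso : ∀ v : V, ∃ w, X.graph.Adj v w := fun v => by
      obtain ⟨w, hw⟩ := exists_ne v
      exact ⟨w, hw.symm, hX v w hw.symm⟩
    obtain ⟨v⟩ := ‹Nonempty V›
    obtain ⟨w, -, B, hB, hv, -⟩ := hiso v
    have : Nonempty X.Flag := ⟨TripleSystem.Flag.mk v ⟨B, hB⟩ hv⟩
    obtain ⟨ρ, hpt, hρ, hface⟩ := X.exists_rotation hX ho.flagPerm.symm
      (fun q => rfl) (fun p q h => Equiv.Perm.sameCycle_inv.2 (ho.sameCycle_flagPerm h)) ⟨B, hB⟩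
    exact ⟨ho.embedding hconn hpt hρ, ho.isUpperEmbedding_embedding hconn hpt hρ hface hiso⟩
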